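/- Fix $\zeta\in(0,1/2)$. For each $n$ let $\sigma^*=\sigma^{*(n)}\in\{\pm1\}^n$ be an arbitrary label vector, let $a=a_n$ and $\epsilon=\epsilon_n$ be real parameters, and put $p=p_n=a_n\log(n)/n$, assumed to satisfy $p_n\le 1$. Let $\mathbf A$ be drawn from the censored block model $\mathsf{CBM}(\sigma^*,p,\zeta)$: $\mathbf A$ is symmetric with zero diagonal, and the entries $A_{i,j}$, $i<j$, are independent, equal to $\sigma^*_i\sigma^*_j$ with probability $p(1-\zeta)$, to $-\sigma^*_i\sigma^*_j$ with probability $p\zeta$, and to $0$ with probability $1-p$. Let $\tilde{\mathbf A}$ be obtained from $\mathbf A$ by ternary randomized response with privacy parameter $\epsilon$: $\tilde{\mathbf A}$ is symmetric with zero diagonal and, given $\mathbf A$, the entries $\tilde A_{i,j}$, $i<j$, are independent, with $\tilde A_{i,j}=A_{i,j}$ with probability $\frac{e^\epsilon}{e^\epsilon+2}$ and equal to each of the two other elements of $\{-1,0,+1\}$ with probability $\frac{1}{e^\epsilon+2}$. Suppose that $\epsilon_n=\Omega(\log n)$, i.e. there is a constant $c>0$ with $\epsilon_n\ge c\log n$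 for all sufficiently large $n$, and that for all sufficiently large $n$ $$a_n>\frac{2\,(n^{3/2}-n)}{(n-1)\log n}\qquad\text{and}\qquad a_n\bigl(\sqrt{1-\zeta}-\sqrt{\zeta}\bigr)^2>\frac{\sqrt n}{\sqrt n-1}\cdot\frac{e^{\epsilon_n}+1}{e^{\epsilon_n}-1}.$$ Then the semidefinite relaxation of the maximum likelihood estimator, run on the perturbed graph, recovers the communities exactly (up to a global flip of the labels): with probability $1-o(1)$ as $n\to\infty$, the semidefinite program $$\max_{\mathbf Y}\ \operatorname{tr}(\tilde{\mathbf A}\mathbf Y)\quad\text{subject to}\quad \mathbf Y\succeq 0,\quad Y_{i,i}=1\ \ (1\le i\le n)$$ has $\mathbf Y^*=\sigma^*(\sigma^*)^{T}$ as its unique maximizer. -/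

import Mathlib

open MeasureTheory ProbabilityTheory Filter Topology

noncomputable section

namespace CBM

instance instMeasurableSpaceSignType : MeasurableSpace SignType := ⊤

instance instDiscreteMeasurableSpaceSignType : DiscreteMeasurableSpace SignType :=
  ⟨fun _ => trivial⟩

/-- A community labelling of `n` vertices: a vector in `{-1, +1}^n`. -/
abbrev Labels (n : ℕ) : Type := Fin n → ℤˣ

/-- The unordered pairs of distinct vertices, written as pairs `i < j`. -/
abbrev Edge (n : ℕ) : Type := {e : Fin n × Fin n // e.1 < e.2}

/-- A signed graph on `n` vertices: a value in `{-1, 0, +1}` for every pair `i < j`. -/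
abbrev SignedGraph (n : ℕ) : Type := Edge n → SignType

/-- The weighted adjacency matrix: symmetric, with zero diagonal. -/
def adjMatrix {n : ℕ} (G : SignedGraph n) : Matrix (Fin n) (Fin n) ℝ :=
  Matrix.of fun i j =>
    if h : i < j then ((G ⟨(i, j), h⟩ : SignType) : ℝ)
    else if h : j < i then ((G ⟨(j, i), h⟩ : SignType) : ℝ)
    else 0

/-- The law on `{-1, 0, +1}` with the given weights. -/
def lawOfWeights (w : SignType → ℝ) : Measure SignType :=
  ∑ x : SignType, ENNReal.ofReal (w x) • Measure.dirac x

/-- The probability that an edge between vertices whose labels have product `s` takes the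
value `x` in the censored block model. -/
def edgeProb (p ζ : ℝ) (s : ℤˣ) (x : SignType) : ℝ :=
  if (x : ℤ) = (s : ℤ) then p * (1 - ζ)
  else if (x : ℤ) = -(s : ℤ) then p * ζ
  else 1 - p

/-- The censored block model `CBM(σ, p, ζ)`: the edges are independent. -/
def cbmLaw {n : ℕ} (σ : Labels n) (p ζ : ℝ) : Measure (SignedGraph n) :=
  Measure.pi fun e => lawOfWeights (edgeProb p ζ (σ e.1.1 * σ e.1.2))

/-- Ternary randomized response: the probability of output `y` on input `x`. -/
def rrProb (ε : ℝ) (x y : SignType) : ℝ :=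
  if x = y then Real.exp ε / (Real.exp ε + 2) else 1 / (Real.exp ε + 2)

/-- The graph perturbation mechanism: given the graph, every edge is passed through ternary
randomized response, independently of the others. -/
def perturbKernel (n : ℕ) (ε : ℝ) : Kernel (SignedGraph n) (SignedGraph n) :=
  Kernel.ofFunOfCountable fun G => Measure.pi fun e => lawOfWeights (rrProb ε (G e))

/-- The law of the perturbed graph when the original graph is drawn from `CBM(σ, p, ζ)`. -/
def perturbedLaw {n : ℕ} (σ : Labels n) (p ζ ε : ℝ) : Measure (SignedGraph n) :=
  (cbmLaw σ p ζ).bind (perturbKernel n ε)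

/-- The feasible set of the semidefinite relaxation. -/
def sdpFeasible (n : ℕ) : Set (Matrix (Fin n) (Fin n) ℝ) :=
  {Y | Y.PosSemidef ∧ ∀ i, Y i i = 1}

/-- The set of maximizers of `Y ↦ tr (A Y)` over the feasible set. -/
def sdpSolutions {n : ℕ} (A : Matrix (Fin n) (Fin n) ℝ) : Set (Matrix (Fin n) (Fin n) ℝ) :=
  {Y | Y ∈ sdpFeasible n ∧ ∀ Z ∈ sdpFeasible n, (A * Z).trace ≤ (A * Y).trace}

/-- The rank-one matrix `σ σᵀ` of a labelling. -/
def labelMatrix {n : ℕ} (σ : Labels n) : Matrix (Fin n) (Fin n) ℝ :=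
  Matrix.of fun i j => (((σ i : ℤˣ) : ℤ) : ℝ) * (((σ j : ℤˣ) : ℤ) : ℝ)

/-- The matrix `σ σᵀ` determines the labelling exactly up to a global flip. -/
theorem labelMatrix_eq_iff {n : ℕ} (σ τ : Labels n) :
    labelMatrix τ = labelMatrix σ ↔ τ = σ ∨ τ = -σ := by
  constructor
  · intro h
    have h' : ∀ i j, τ i * τ j = σ i * σ j := by
      intro i j
      have := congrFun (congrFun h i) j
      simp only [labelMatrix, Matrix.of_apply] at this
      exact Units.ext (by exact_mod_cast this)
    rcases n with _ | n
    · left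
      funext i
      exact i.elim0
    · rcases Int.units_eq_one_or (τ 0) with a | a <;> rcases Int.units_eq_one_or (σ 0) with b | b
      · left; funext i; simpa [a, b] using h' 0 i
      · right; funext i; simpa [a, b] using h' 0 i
      · right; funext i
        have := h' 0 i
        rw [a, b] at this
        simp only [one_mul, neg_mul] at this
        simp [← this]
      · left; funext i; simpa [a, b] using h' 0 i
  · rintro (rfl | rfl)
    · rfl
    · ext i j
      simp [labelMatrix]

/-- The event of exact recovery: on input `G` the relaxed maximum likelihood estimator is well
defined and correct, that is, `σ σᵀ` is the one and only maximizer. -/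
def SDPRecovers {n : ℕ} (σ : Labels n) (G : SignedGraph n) : Prop :=
  sdpSolutions (adjMatrix G) = {labelMatrix σ}

end CBM

end

/-! The density condition makes the expected degree `n * p` at least `√n`, so the signal dominates
the noise by a power of `n` and crude moment bounds suffice.

Multiplying entry `(i, j)` by `σ i * σ j` turns the target into the all-ones matrix and the data
into mean `m` off the diagonal plus centered noise. A feasible matrix is a Gram matrix of unit
vectors, so the optimality gap is a sum of Laplacian forms of the data, one per coordinate. The mean
contributes `m` times the form of the complete graph; the noise costs at most `2τ / n` times that
form once its row sums and its quadratic form are at most `τ` (`neg_le_sum_mul_sub_sq`). Hence `2τ <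
n m` gives a unique maximizer (`sdpRecovers_of_trace_pow_le`).

Both conditions come from Markov's inequality for moments of a fixed order `2k`, `k = 2 ^ r`.
Centering removes every product in which some edge occurs once, and a walk has at most one more
vertex than edges, so the expected trace is `O(n z ^ k)` with `z / n` bounding the variance of an
entry. With `τ = n m / 4` the failure probability is `O(n (z / (n m)²) ^ k)`. This ratio is `O(n ^
(-c))` (`noise_ratio_le`), and `r` is chosen with `c k > 1`. -/

namespace CBM

/-! ### Trace powers, quadratic forms and Laplacian forms -/

open Matrix in
theorem dotProduct_sq_le {ι : Type*} [Fintype ι] (x y : ι → ℝ) :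
    (x ⬝ᵥ y) ^ 2 ≤ (x ⬝ᵥ x) * (y ⬝ᵥ y) := by
  simpa [dotProduct, pow_two] using Finset.sum_mul_sq_le_sq_mul_sq Finset.univ x y

open Matrix in
/-- For a symmetric matrix, a bound on the trace of a power with exponent `2 ^ (r + 1)` bounds the
Euclidean operator norm. -/
theorem mulVec_dotProduct_self_le_of_trace_pow {ι : Type*} [Fintype ι] [DecidableEq ι] (r : ℕ) :
    ∀ (M : Matrix ι ι ℝ) (τ : ℝ), M.IsSymm → (M ^ 2 ^ (r + 1)).trace ≤ τ ^ 2 ^ (r + 1) →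
      ∀ x : ι → ℝ, (M *ᵥ x) ⬝ᵥ (M *ᵥ x) ≤ τ ^ 2 * (x ⬝ᵥ x) := by
  induction r with
  | zero =>
    intro M τ hM h x
    have htr : (M ^ 2 ^ (0 + 1)).trace = ∑ i, ∑ j, M i j ^ 2 := by
      simp only [zero_add, pow_one, pow_two, Matrix.trace, Matrix.diag, Matrix.mul_apply]
      exact Finset.sum_congr rfl fun i _ => Finset.sum_congr rfl fun j _ => by rw [hM.apply]
    rw [htr] at h
    have hx : 0 ≤ x ⬝ᵥ x := Finset.sum_nonneg fun i _ => mul_self_nonneg _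
    calc (M *ᵥ x) ⬝ᵥ (M *ᵥ x) = ∑ i, (∑ j, M i j * x j) ^ 2 :=
          Finset.sum_congr rfl fun i _ => by simp [Matrix.mulVec, dotProduct, pow_two]
      _ ≤ ∑ i, (∑ j, M i j ^ 2) * (x ⬝ᵥ x) := by
          refine Finset.sum_le_sum fun i _ => ?_
          refine (Finset.sum_mul_sq_le_sq_mul_sq _ _ _).trans_eq ?_
          simp [dotProduct, pow_two]
      _ = (∑ i, ∑ j, M i j ^ 2) * (x ⬝ᵥ x) := by rw [Finset.sum_mul]
      _ ≤ τ ^ 2 * (x ⬝ᵥ x) := by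
          refine mul_le_mul_of_nonneg_right ?_ hx
          simpa using h
  | succ r ih =>
    intro M τ hM h x
    have hx : 0 ≤ x ⬝ᵥ x := Finset.sum_nonneg fun i _ => mul_self_nonneg _
    -- Squaring the matrix halves the exponent, and symmetry gives `|M x|² = ⟨x, M² x⟩`, so
    -- Cauchy–Schwarz brings the bound for `M²` back to `M`. The base case is the Frobenius bound.
    have h' : ((M ^ 2) ^ 2 ^ (r + 1)).trace ≤ (τ ^ 2) ^ 2 ^ (r + 1) := by
      rw [← pow_mul M, ← pow_mul τ, ← pow_succ' 2 (r + 1)]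
      exact h
    have h2 := ih (M ^ 2) (τ ^ 2) (hM.pow 2) h' x
    have hself : (M *ᵥ x) ⬝ᵥ (M *ᵥ x) = x ⬝ᵥ (M ^ 2 *ᵥ x) := by
      rw [pow_two, ← Matrix.mulVec_mulVec, Matrix.dotProduct_mulVec x, ← Matrix.mulVec_transpose,
        hM.eq]
    have hcs : (x ⬝ᵥ (M ^ 2 *ᵥ x)) ^ 2 ≤ (x ⬝ᵥ x) * ((M ^ 2 *ᵥ x) ⬝ᵥ (M ^ 2 *ᵥ x)) :=
      dotProduct_sq_le _ _
    rw [hself]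
    refine abs_le_of_sq_le_sq' ?_ (by positivity) |>.2
    calc _ ≤ _ := hcs
      _ ≤ (x ⬝ᵥ x) * ((τ ^ 2) ^ 2 * (x ⬝ᵥ x)) := by gcongr
      _ = _ := by ring

open Matrix in
theorem dotProduct_mulVec_le_of_trace_pow {ι : Type*} [Fintype ι] [DecidableEq ι] {r : ℕ}
    {M : Matrix ι ι ℝ} {τ : ℝ} (hτ : 0 ≤ τ) (hM : M.IsSymm)
    (h : (M ^ 2 ^ (r + 1)).trace ≤ τ ^ 2 ^ (r + 1)) (x : ι → ℝ) :
    x ⬝ᵥ (M *ᵥ x) ≤ τ * (x ⬝ᵥ x) := by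
  have hx : 0 ≤ x ⬝ᵥ x := Finset.sum_nonneg fun i _ => mul_self_nonneg _
  have hcs : (x ⬝ᵥ (M *ᵥ x)) ^ 2 ≤ (x ⬝ᵥ x) * ((M *ᵥ x) ⬝ᵥ (M *ᵥ x)) :=
    dotProduct_sq_le _ _
  refine abs_le_of_sq_le_sq' ?_ (by positivity) |>.2
  calc _ ≤ _ := hcs
    _ ≤ (x ⬝ᵥ x) * (τ ^ 2 * (x ⬝ᵥ x)) := by
      gcongr; exact mulVec_dotProduct_self_le_of_trace_pow r M τ hM h x
    _ = _ := by ring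

open Matrix in
/-- A symmetric matrix with small row sums and a small quadratic form has a Laplacian form
dominated by that of the complete graph. -/
theorem neg_le_sum_mul_sub_sq {n : ℕ} (hn : 0 < n) {N : Matrix (Fin n) (Fin n) ℝ} {τ : ℝ}
    (hN : N.IsSymm) (hrow : ∀ i, |∑ j, N i j| ≤ τ)
    (hquad : ∀ x : Fin n → ℝ, x ⬝ᵥ (N *ᵥ x) ≤ τ * (x ⬝ᵥ x)) (y : Fin n → ℝ) :
    -(2 * τ) * ∑ i, ∑ j, (y i - y j) ^ 2 ≤ n * ∑ i, ∑ j, N i j * (y i - y j) ^ 2 := by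
  have hn' : (0 : ℝ) < n := by exact_mod_cast hn
  -- Only differences of `y` enter, so `y` may be centered; on sum-zero vectors the complete-graph
  -- form is exactly `2 n |x|²`.
  set c : ℝ := (∑ i, y i) / n with hc
  set x : Fin n → ℝ := fun i => y i - c with hx
  have hsum : ∑ i, x i = 0 := by
    simp only [hx, Finset.sum_sub_distrib, Finset.sum_const, Finset.card_univ, Fintype.card_fin,
      nsmul_eq_mul, hc]
    field_simp
    ring
  have hdiff : ∀ i j, y i - y j = x i - x j := fun i j => by simp [hx]
  simp only [hdiff]
  have hcomplete : ∑ i, ∑ j, (x i - x j) ^ 2 = 2 * n * (x ⬝ᵥ x) := by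
    have : ∀ i j, (x i - x j) ^ 2 = x i * x i + x j * x j - 2 * x i * x j := fun i j => by ring
    simp only [this, Finset.sum_sub_distrib, Finset.sum_add_distrib, ← Finset.mul_sum, hsum,
      Finset.sum_const, Finset.card_univ, Fintype.card_fin, nsmul_eq_mul, dotProduct, mul_zero]
    simp only [Finset.mul_sum, sub_zero]
    rw [← Finset.sum_add_distrib]
    exact Finset.sum_congr rfl fun i _ => by ring
  -- Laplacian as degree part minus adjacency part: each loses at most `2 τ |x|²`, which is where
  -- the constant `2 * τ` comes from.
  have hlap : ∑ i, ∑ j, N i j * (x i - x j) ^ 2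
      = 2 * ∑ i, (∑ j, N i j) * (x i * x i) - 2 * (x ⬝ᵥ (N *ᵥ x)) := by
    have h1 : ∀ i j, N i j * (x i - x j) ^ 2
        = N i j * (x i * x i) + N i j * (x j * x j) - 2 * (x i * (N i j * x j)) :=
      fun i j => by ring
    have h2 : ∑ i, ∑ j, N i j * (x j * x j) = ∑ i, ∑ j, N i j * (x i * x i) := by
      rw [Finset.sum_comm]
      exact Finset.sum_congr rfl fun i _ => Finset.sum_congr rfl fun j _ => by rw [hN.apply]
    simp only [h1, Finset.sum_sub_distrib, Finset.sum_add_distrib, h2, ← Finset.mul_sum,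
      ← Finset.sum_mul, dotProduct, Matrix.mulVec]
    ring
  have hdeg : -τ * (x ⬝ᵥ x) ≤ ∑ i, (∑ j, N i j) * (x i * x i) := by
    rw [dotProduct, Finset.mul_sum]
    exact Finset.sum_le_sum fun i _ =>
      mul_le_mul_of_nonneg_right (neg_le_of_abs_le (hrow i)) (mul_self_nonneg _)
  rw [hcomplete, hlap]
  nlinarith [hquad x, mul_le_mul_of_nonneg_left (hquad x) hn'.le,
    mul_le_mul_of_nonneg_left hdeg hn'.le]

/-! ### Gauge transformation and the optimality gap of the semidefinite program -/

/-- The label of a vertex as a real number. -/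
def realLabel {n : ℕ} (σ : Labels n) (i : Fin n) : ℝ := (((σ i : ℤˣ) : ℤ) : ℝ)

theorem realLabel_mul_self {n : ℕ} (σ : Labels n) (i : Fin n) :
    realLabel σ i * realLabel σ i = 1 := by
  rcases Int.units_eq_one_or (σ i) with h | h <;> simp [realLabel, h]

/-- The centered adjacency matrix, in the gauge where all labels are `+1`. -/
def noiseMatrix {n : ℕ} (σ : Labels n) (m : ℝ) (G : SignedGraph n) : Matrix (Fin n) (Fin n) ℝ :=
  Matrix.of fun i j =>
    if i = j then 0 else realLabel σ i * realLabel σ j * adjMatrix G i j - m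

theorem adjMatrix_comm {n : ℕ} (G : SignedGraph n) (i j : Fin n) :
    adjMatrix G i j = adjMatrix G j i := by
  simp only [adjMatrix, Matrix.of_apply]
  rcases lt_trichotomy i j with h | h | h
  · simp [h, h.not_gt]
  · simp [h]
  · simp [h, h.not_gt]

theorem noiseMatrix_isSymm {n : ℕ} (σ : Labels n) (m : ℝ) (G : SignedGraph n) :
    (noiseMatrix σ m G).IsSymm := by
  ext i j
  simp only [noiseMatrix, Matrix.transpose_apply, Matrix.of_apply, adjMatrix_comm G j i,
    eq_comm (a := j), mul_comm (realLabel σ j)]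

theorem labelMatrix_mem_sdpFeasible {n : ℕ} (σ : Labels n) : labelMatrix σ ∈ sdpFeasible n := by
  refine ⟨?_, fun i => realLabel_mul_self σ i⟩
  have : labelMatrix σ = Matrix.vecMulVec (realLabel σ) (star (realLabel σ)) := by
    ext i j; simp [labelMatrix, Matrix.vecMulVec_apply, realLabel]
  rw [this]
  exact Matrix.posSemidef_vecMulVec_self_star _

theorem trace_adjMatrix_mul {n : ℕ} (G : SignedGraph n) {Z : Matrix (Fin n) (Fin n) ℝ} :
    (adjMatrix G * Z).trace = ∑ i, ∑ j, adjMatrix G i j * Z j i := by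
  simp [Matrix.trace, Matrix.mul_apply]

open scoped MatrixOrder in
theorem exists_conjTranspose_mul_self_of_posSemidef {n : ℕ} {Z : Matrix (Fin n) (Fin n) ℝ}
    (hZ : Z.PosSemidef) : ∃ C : Matrix (Fin n) (Fin n) ℝ, Z = C.conjTranspose * C := by
  obtain ⟨X, hX, -, h⟩ :=
    CFC.exists_sqrt_of_isSelfAdjoint_of_quasispectrumRestricts hZ.isHermitian
      (QuasispectrumRestricts.nnreal_of_nonneg hZ.nonneg)
  exact ⟨X, by rw [← Matrix.star_eq_conjTranspose, hX.star_eq, h]⟩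

/-- A feasible matrix is a Gram matrix of unit vectors, so its deviation from the label matrix is a
sum of squared differences. -/
theorem exists_sum_sub_sq_eq_of_mem_sdpFeasible {n : ℕ} (σ : Labels n)
    {Z : Matrix (Fin n) (Fin n) ℝ} (hZ : Z ∈ sdpFeasible n) :
    ∃ y : Fin n → Fin n → ℝ, ∀ i j,
      1 - realLabel σ i * realLabel σ j * Z i j = ∑ k, (1 / 2) * (y k i - y k j) ^ 2 := by
  obtain ⟨hpsd, hdiag⟩ := hZ
  obtain ⟨C, rfl⟩ := exists_conjTranspose_mul_self_of_posSemidef hpsd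
  set s := realLabel σ with hs
  -- The vector of vertex `i` is column `i` of `C`, with its sign flipped by the label; the unit
  -- diagonal of `Z` makes it a unit vector.
  set y : Fin n → Fin n → ℝ := fun k i => s i * C k i with hy
  have hW : ∀ i j, s i * s j * (C.conjTranspose * C) i j = ∑ k, y k i * y k j := by
    intro i j
    simp only [Matrix.mul_apply, Matrix.conjTranspose_apply, star_trivial, Finset.mul_sum, hy]
    exact Finset.sum_congr rfl fun k _ => by ring
  have hWd : ∀ i, ∑ k, y k i * y k i = 1 := by
    intro i; rw [← hW, hdiag, mul_one, realLabel_mul_self]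
  refine ⟨y, fun i j => ?_⟩
  have : ∀ k, (1 / 2) * (y k i - y k j) ^ 2
      = (1 / 2) * (y k i * y k i) + (1 / 2) * (y k j * y k j) - y k i * y k j :=
    fun k => by ring
  simp only [this, Finset.sum_sub_distrib, Finset.sum_add_distrib, ← Finset.mul_sum, hWd, hW]
  ring

/-- The gap of the semidefinite program is strictly coercive when the noise is small. -/
theorem mul_sum_le_trace_gap {n : ℕ} (hn : 0 < n) (σ : Labels n) (G : SignedGraph n) {m τ : ℝ}
    (hrow : ∀ i, |∑ j, noiseMatrix σ m G i j| ≤ τ)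
    (hquad : ∀ x : Fin n → ℝ, x ⬝ᵥ (noiseMatrix σ m G).mulVec x ≤ τ * (x ⬝ᵥ x))
    {Z : Matrix (Fin n) (Fin n) ℝ} (hZ : Z ∈ sdpFeasible n) :
    (n * m - 2 * τ) * ∑ i, ∑ j, (1 - realLabel σ i * realLabel σ j * Z i j)
      ≤ n * ((adjMatrix G * labelMatrix σ).trace - (adjMatrix G * Z).trace) := by
  obtain ⟨y, hy⟩ := exists_sum_sub_sq_eq_of_mem_sdpFeasible σ hZ
  have hgap : (adjMatrix G * labelMatrix σ).trace - (adjMatrix G * Z).trace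
      = ∑ i, ∑ j, (realLabel σ i * realLabel σ j * adjMatrix G i j)
          * (1 - realLabel σ i * realLabel σ j * Z i j) := by
    rw [trace_adjMatrix_mul, trace_adjMatrix_mul, ← Finset.sum_sub_distrib]
    refine Finset.sum_congr rfl fun i _ => ?_
    rw [← Finset.sum_sub_distrib]
    refine Finset.sum_congr rfl fun j _ => ?_
    have hsym : Z j i = Z i j := by simpa using hZ.1.isHermitian.apply i j
    have h3 : labelMatrix σ j i = realLabel σ j * realLabel σ i := rfl
    rw [hsym, h3]
    linear_combination (adjMatrix G i j * Z i j * (realLabel σ j * realLabel σ j))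
      * realLabel_mul_self σ i + adjMatrix G i j * Z i j * realLabel_mul_self σ j
  have hcong : ∀ i j, (realLabel σ i * realLabel σ j * adjMatrix G i j)
      * (1 - realLabel σ i * realLabel σ j * Z i j)
      = ∑ k, (1 / 2) * (noiseMatrix σ m G i j * (y k i - y k j) ^ 2 + m * (y k i - y k j) ^ 2) := by
    intro i j
    rw [hy, Finset.mul_sum]
    refine Finset.sum_congr rfl fun k _ => ?_
    -- On the diagonal the noise is `0` instead of data minus `m`, but the squared difference
    -- vanishes there.
    by_cases hij : i = j
    · simp [hij]
    · simp only [noiseMatrix, Matrix.of_apply, hij, if_false]; ring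
  simp only [hgap, hcong]
  simp only [hy]
  rw [Finset.sum_comm_cycle (f := fun i j k => (1 / 2 : ℝ) * (y k i - y k j) ^ 2),
    Finset.sum_comm_cycle (f := fun i j k => (1 / 2 : ℝ) *
      (noiseMatrix σ m G i j * (y k i - y k j) ^ 2 + m * (y k i - y k j) ^ 2)),
    Finset.mul_sum, Finset.mul_sum]
  refine Finset.sum_le_sum fun k _ => ?_
  have h := neg_le_sum_mul_sub_sq hn (noiseMatrix_isSymm σ m G) hrow hquad (y k)
  simp only [← Finset.mul_sum, Finset.sum_add_distrib]
  nlinarith [h]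

/-- If the centered adjacency matrix has small row sums and a small trace moment, then the
semidefinite program recovers the labels. -/
theorem sdpRecovers_of_trace_pow_le {n : ℕ} (hn : 0 < n) (σ : Labels n) (G : SignedGraph n)
    {m τ : ℝ} {r : ℕ} (hτ : 0 ≤ τ) (hm : 2 * τ < n * m)
    (hrow : ∀ i, |∑ j, noiseMatrix σ m G i j| ≤ τ)
    (htr : (noiseMatrix σ m G ^ 2 ^ (r + 1)).trace ≤ τ ^ 2 ^ (r + 1)) : SDPRecovers σ G := by
  have hquad := dotProduct_mulVec_le_of_trace_pow hτ (noiseMatrix_isSymm σ m G) htr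
  have hn' : (0 : ℝ) < n := by exact_mod_cast hn
  have hle : ∀ Z ∈ sdpFeasible n, ∀ i j, 0 ≤ 1 - realLabel σ i * realLabel σ j * Z i j := by
    intro Z hZ i j
    obtain ⟨y, hy⟩ := exists_sum_sub_sq_eq_of_mem_sdpFeasible σ hZ
    rw [hy]
    exact Finset.sum_nonneg fun k _ => by positivity
  have hopt : ∀ Z ∈ sdpFeasible n,
      (adjMatrix G * Z).trace ≤ (adjMatrix G * labelMatrix σ).trace := by
    intro Z hZ
    have h := mul_sum_le_trace_gap hn σ G hrow hquad hZ
    have h0 : 0 ≤ ∑ i, ∑ j, (1 - realLabel σ i * realLabel σ j * Z i j) :=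
      Finset.sum_nonneg fun i _ => Finset.sum_nonneg fun j _ => hle Z hZ i j
    have h1 : 0 ≤ n * ((adjMatrix G * labelMatrix σ).trace - (adjMatrix G * Z).trace) :=
      (mul_nonneg (by linarith) h0).trans h
    linarith [nonneg_of_mul_nonneg_right h1 hn']
  ext Z
  simp only [Set.mem_singleton_iff]
  constructor
  · rintro ⟨hZ, hmax⟩
    have h := mul_sum_le_trace_gap hn σ G hrow hquad hZ
    have heq := hmax _ (labelMatrix_mem_sdpFeasible σ)
    -- A second maximizer has zero gap, so strict coercivity kills this sum; its terms are
    -- nonnegative, so each vanishes and `Z` is the label matrix.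
    have h0 : ∑ i, ∑ j, (1 - realLabel σ i * realLabel σ j * Z i j) ≤ 0 := by
      by_contra! hpos
      nlinarith [mul_pos (sub_pos.mpr hm) hpos]
    have h1 := (Finset.sum_eq_zero_iff_of_nonneg
      (fun i _ => Finset.sum_nonneg fun j _ => hle Z hZ i j)).mp
      (le_antisymm h0 (Finset.sum_nonneg fun i _ => Finset.sum_nonneg fun j _ => hle Z hZ i j))
    ext i j
    have h2 := (Finset.sum_eq_zero_iff_of_nonneg (fun j _ => hle Z hZ i j)).mp
      (h1 i (Finset.mem_univ _)) j (Finset.mem_univ _)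
    have hi := realLabel_mul_self σ i
    have hj := realLabel_mul_self σ j
    change Z i j = realLabel σ i * realLabel σ j
    linear_combination (-(realLabel σ i * realLabel σ j)) * h2
      - Z i j * realLabel σ j * realLabel σ j * hi - Z i j * hj
  · rintro rfl
    exact ⟨labelMatrix_mem_sdpFeasible σ, hopt⟩

/-! ### Mixed moments under a finite product law -/

/-- The weight of a configuration under a product of weights. -/
def prodWeight {E α : Type*} [Fintype E] (w : E → α → ℝ) (G : E → α) : ℝ := ∏ e, w e (G e)

theorem sum_prodWeight_mul_prod {E α : Type*} [Fintype E] [DecidableEq E] [Fintype α]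
    (w g : E → α → ℝ) :
    ∑ G, prodWeight w G * ∏ e, g e (G e) = ∏ e, ∑ x, w e x * g e x := by
  simp only [prodWeight, ← Finset.prod_mul_distrib]
  rw [Finset.prod_univ_sum, Fintype.piFinset_univ]

theorem sum_prodWeight {E α : Type*} [Fintype E] [DecidableEq E] [Fintype α]
    {w : E → α → ℝ} (hw : ∀ e, ∑ x, w e x = 1) : ∑ G, prodWeight w G = 1 := by
  simpa [hw] using sum_prodWeight_mul_prod w fun _ _ => 1

/-- All but two of the factors can be bounded by `2`, leaving the variance. Order one is excluded: a
variance bound does not control the mean linearly. -/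
theorem abs_sum_mul_pow_le {α : Type*} [Fintype α] {w g : α → ℝ} {q : ℝ} (hw0 : ∀ x, 0 ≤ w x)
    (hw1 : ∑ x, w x = 1) (hvar : ∑ x, w x * g x ^ 2 ≤ q) (hg : ∀ x, |g x| ≤ 2) {m : ℕ}
    (hm : m ≠ 1) : |∑ x, w x * g x ^ m| ≤ 2 ^ m * if m = 0 then 1 else q := by
  rcases m with _ | _ | m
  · simp [hw1]
  · exact absurd rfl hm
  · have hq : 0 ≤ q := (Finset.sum_nonneg fun x _ => mul_nonneg (hw0 x) (sq_nonneg _)).trans hvar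
    have hterm : ∀ x, |w x * g x ^ (m + 1 + 1)| ≤ 2 ^ m * (w x * g x ^ 2) := by
      intro x
      rw [abs_mul, abs_of_nonneg (hw0 x), abs_pow, add_assoc, pow_add, one_add_one_eq_two, sq_abs,
        mul_left_comm]
      exact mul_le_mul_of_nonneg_right (pow_le_pow_left₀ (abs_nonneg _) (hg x) m)
        (mul_nonneg (hw0 x) (sq_nonneg _))
    calc |∑ x, w x * g x ^ (m + 1 + 1)| ≤ ∑ x, |w x * g x ^ (m + 1 + 1)| :=
          Finset.abs_sum_le_sum_abs _ _
      _ ≤ ∑ x, 2 ^ m * (w x * g x ^ 2) := Finset.sum_le_sum fun x _ => hterm x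
      _ ≤ 2 ^ m * q := by rw [← Finset.mul_sum]; gcongr
      _ ≤ 2 ^ (m + 1 + 1) * q := by gcongr <;> norm_num; omega
      _ = _ := by simp

/-- The mixed moment of even order of independent centered variables with variance at most `z / N`:
only products in which every factor is repeated contribute. -/
theorem sum_prodWeight_mul_prod_comp_le {E α : Type*} [Fintype E] [DecidableEq E] [Fintype α]
    {w g : E → α → ℝ} {z N : ℝ} (hw0 : ∀ e x, 0 ≤ w e x) (hw1 : ∀ e, ∑ x, w e x = 1)
    (hmean : ∀ e, ∑ x, w e x * g e x = 0) (hvar : ∀ e, ∑ x, w e x * g e x ^ 2 ≤ z * N⁻¹)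
    (hg : ∀ e x, |g e x| ≤ 2) (hz : 1 ≤ z) (hN : 0 < N) {k : ℕ} (f : Fin (2 * k) → E) :
    ∑ G, prodWeight w G * ∏ t, g (f t) (G (f t))
      ≤ 2 ^ (2 * k) * z ^ k * N⁻¹ ^ (Finset.univ.image f).card := by
  classical
  set m : E → ℕ := fun e => (Finset.univ.filter fun t => f t = e).card with hm
  have hmsum : ∑ e, m e = 2 * k := by
    rw [← Finset.card_eq_sum_card_fiberwise (fun t _ => Finset.mem_coe.2 (Finset.mem_univ (f t)))]
    simp
  have hprod : ∀ G : E → α, ∏ t, g (f t) (G (f t)) = ∏ e, g e (G e) ^ m e := by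
    intro G
    rw [← Finset.prod_fiberwise_of_maps_to (fun t _ => Finset.mem_univ (f t))]
    refine Finset.prod_congr rfl fun e _ => ?_
    rw [hm, ← Finset.prod_const]
    exact Finset.prod_congr rfl fun t ht => by rw [(Finset.mem_filter.1 ht).2]
  have hsupp : ∀ e, e ∈ Finset.univ.image f ↔ m e ≠ 0 := by
    intro e
    simp [hm, Finset.filter_eq_empty_iff]
  simp only [hprod]
  rw [sum_prodWeight_mul_prod w fun e x => g e x ^ m e]
  -- A variable of multiplicity one contributes its mean, which is zero, as an independent factor.
  by_cases hone : ∃ e, m e = 1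
  · obtain ⟨e, he⟩ := hone
    rw [Finset.prod_eq_zero (Finset.mem_univ e) (by simp [he, hmean])]
    positivity
  · push Not at hone
    -- Every variable used now occurs at least twice among `2 * k` factors. With `1 ≤ z` this allows
    -- replacing `z ^ #image` by `z ^ k`.
    have hcard : (Finset.univ.image f).card ≤ k := by
      have : ∑ e ∈ Finset.univ.image f, 2 ≤ ∑ e, m e := by
        refine (Finset.sum_le_sum fun e he => ?_).trans
          (Finset.sum_le_sum_of_subset (Finset.subset_univ (Finset.univ.image f)))
        have h0 := (hsupp e).1 he
        have h1 := hone e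
        omega
      rw [hmsum, Finset.sum_const, smul_eq_mul] at this
      omega
    calc ∏ e, ∑ x, w e x * g e x ^ m e ≤ |∏ e, ∑ x, w e x * g e x ^ m e| := le_abs_self _
      _ = ∏ e, |∑ x, w e x * g e x ^ m e| := Finset.abs_prod _ _
      _ ≤ ∏ e, (2 ^ m e * if m e = 0 then 1 else z * N⁻¹) :=
          Finset.prod_le_prod (fun _ _ => abs_nonneg _) fun e _ =>
            abs_sum_mul_pow_le (hw0 e) (hw1 e) (hvar e) (hg e) (hone e)
      _ = 2 ^ (2 * k) * (z * N⁻¹) ^ (Finset.univ.image f).card := by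
          rw [Finset.prod_mul_distrib, Finset.prod_pow_eq_pow_sum, hmsum, Finset.prod_ite,
            Finset.prod_const_one, one_mul, Finset.prod_const]
          congr 3
          ext e
          simp only [hsupp, Finset.mem_filter, Finset.mem_univ, true_and, ne_eq]
      _ ≤ 2 ^ (2 * k) * z ^ k * N⁻¹ ^ (Finset.univ.image f).card := by
          rw [mul_pow, ← mul_assoc]
          gcongr

/-! ### Counting words and walks -/

/-- Summing `N ^ (-#image)` over all words of length `L` in an alphabet of size `N`. -/
theorem sum_inv_pow_card_image_le {V : Type*} [Fintype V] [DecidableEq V] (L : ℕ) :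
    ∑ f : Fin L → V, (Fintype.card V : ℝ)⁻¹ ^ (Finset.univ.image f).card ≤ L.factorial := by
  induction L with
  | zero => simp
  | succ L ih =>
    set ρ : ℝ := (Fintype.card V : ℝ)⁻¹ with hρ
    have hρ0 : 0 ≤ ρ := by positivity
    have himage : ∀ (x : V) (f : Fin L → V), Finset.univ.image (Fin.cons x f : Fin (L + 1) → V)
        = insert x (Finset.univ.image f) := by
      intro x f
      ext y
      simp [Fin.exists_fin_succ, eq_comm]
    rw [← (Fin.consEquiv fun _ => V).sum_comp, Fintype.sum_prod_type_right]
    -- The added letter either repeats one of at most `L` letters at no cost, or is new and costs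
    -- `ρ`; all new letters together contribute at most `1`.
    have hstep : ∀ f : Fin L → V, ∑ x, ρ ^ (Finset.univ.image (Fin.cons x f : Fin (L + 1) → V)).card
        ≤ (L + 1) * ρ ^ (Finset.univ.image f).card := by
      intro f
      have hle : ∀ x : V, ρ ^ (Finset.univ.image (Fin.cons x f : Fin (L + 1) → V)).card
          ≤ (if x ∈ Finset.univ.image f then ρ ^ (Finset.univ.image f).card else 0)
            + ρ * ρ ^ (Finset.univ.image f).card := by
        intro x
        rw [himage]
        split_ifs with hx
        · rw [Finset.insert_eq_of_mem hx]
          have : 0 ≤ ρ * ρ ^ (Finset.univ.image f).card := by positivity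
          linarith
        · rw [Finset.card_insert_of_notMem hx, pow_succ', zero_add]
      refine (Finset.sum_le_sum fun x _ => hle x).trans ?_
      rw [Finset.sum_add_distrib, Finset.sum_ite_mem, Finset.univ_inter, Finset.sum_const,
        Finset.sum_const, nsmul_eq_mul, nsmul_eq_mul, Finset.card_univ, ← mul_assoc, ← add_mul]
      refine mul_le_mul_of_nonneg_right (add_le_add ?_ ?_) (by positivity)
      · have : (Finset.univ.image f).card ≤ L := by
          simpa using Finset.card_image_le (s := Finset.univ) (f := f)
        exact_mod_cast this
      · exact mul_inv_le_one
    refine (Finset.sum_le_sum fun f _ => hstep f).trans ?_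
    rw [← Finset.mul_sum, Nat.factorial_succ]
    push_cast
    gcongr

/-- A walk visits at most one vertex more than it uses edges. -/
theorem card_image_le_card_image_edge_add_one {V : Type*} [DecidableEq V] {L : ℕ}
    (w : Fin (L + 1) → V) :
    (Finset.univ.image w).card
      ≤ (Finset.univ.image fun t : Fin L => s(w t.castSucc, w t.succ)).card + 1 := by
  induction L with
  | zero => exact Finset.card_image_le.trans (by simp)
  | succ L ih =>
    have hih := ih fun t => w t.succ
    set S := Finset.univ.image fun t : Fin (L + 1) => w t.succ with hS
    set T := Finset.univ.image fun t : Fin L => s(w t.castSucc.succ, w t.succ.succ) with hT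
    have hw : Finset.univ.image w = insert (w 0) S := by
      ext y; simp [hS, Fin.exists_fin_succ, eq_comm]
    have he : (Finset.univ.image fun t : Fin (L + 1) => s(w t.castSucc, w t.succ))
        = insert s(w 0, w 1) T := by
      ext y; simp [hT, Fin.exists_fin_succ, eq_comm]
    rw [hw, he]
    by_cases h : w 0 ∈ S
    · rw [Finset.insert_eq_of_mem h]
      exact hih.trans (Nat.succ_le_succ (Finset.card_le_card (Finset.subset_insert _ _)))
    · have h' : s(w 0, w 1) ∉ T := by
        intro hmem
        obtain ⟨t, -, ht⟩ := Finset.mem_image.1 hmem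
        have : w 0 ∈ s(w t.castSucc.succ, w t.succ.succ) := by rw [ht]; exact Sym2.mem_mk_left _ _
        rcases Sym2.mem_iff.1 this with h0 | h0 <;>
          exact h (h0 ▸ Finset.mem_image_of_mem _ (Finset.mem_univ _))
      rw [Finset.card_insert_of_notMem h, Finset.card_insert_of_notMem h']
      omega

theorem pow_apply_eq_sum_walk {V : Type*} [Fintype V] [DecidableEq V] (M : Matrix V V ℝ) (L : ℕ)
    (i j : V) :
    (M ^ L) i j = ∑ w : Fin (L + 1) → V, if w 0 = i ∧ w (Fin.last L) = j then
      ∏ t : Fin L, M (w t.castSucc) (w t.succ) else 0 := by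
  induction L generalizing i with
  | zero =>
    rw [← (Equiv.funUnique (Fin 1) V).symm.sum_comp]
    by_cases h : i = j
    · subst h; simp [Equiv.funUnique]
    · simp only [pow_zero, Matrix.one_apply, h, if_false]
      refine (Finset.sum_eq_zero fun x _ => if_neg ?_).symm
      rintro ⟨h0, h1⟩
      exact h (h0.symm.trans h1)
  | succ L ih =>
    rw [pow_succ', Matrix.mul_apply]
    simp only [ih, Finset.mul_sum]
    rw [← (Fin.consEquiv fun _ => V).sum_comp, Fintype.sum_prod_type_right, Finset.sum_comm]
    refine Finset.sum_congr rfl fun w _ => ?_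
    rw [Finset.sum_eq_single (w 0), Finset.sum_eq_single i]
    · simp [Fin.consEquiv, Fin.prod_univ_succ, ← Fin.succ_last]
    · intro y _ hy; simp [Fin.consEquiv, hy]
    · simp
    · intro y _ hy; simp [hy.symm]
    · simp

theorem trace_pow_eq_sum_walk {V : Type*} [Fintype V] [DecidableEq V] (M : Matrix V V ℝ) (L : ℕ) :
    (M ^ L).trace = ∑ w : Fin (L + 1) → V, if w 0 = w (Fin.last L) then
      ∏ t : Fin L, M (w t.castSucc) (w t.succ) else 0 := by
  simp only [Matrix.trace, Matrix.diag, pow_apply_eq_sum_walk]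
  rw [Finset.sum_comm]
  refine Finset.sum_congr rfl fun w _ => ?_
  rw [Finset.sum_eq_single (w 0)]
  · simp [eq_comm]
  · intro y _ hy; simp [hy.symm]
  · simp

/-! ### The law, mean and variance of a perturbed edge -/

theorem sum_signType (f : SignType → ℝ) : ∑ x, f x = f 0 + f (-1) + f 1 := by
  have : (Finset.univ : Finset SignType) = {0, -1, 1} := by decide
  rw [this, Finset.sum_insert (by decide), Finset.sum_insert (by decide), Finset.sum_singleton,
    add_assoc]

/-- The law of an edge of the perturbed graph. -/
noncomputable def perturbedProb (p ζ ε : ℝ) (s : ℤˣ) (y : SignType) : ℝ :=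
  ∑ x, edgeProb p ζ s x * rrProb ε x y

theorem edgeProb_nonneg {p ζ : ℝ} (hp : p ∈ Set.Icc (0 : ℝ) 1) (hζ : ζ ∈ Set.Icc (0 : ℝ) 1)
    (s : ℤˣ) (x : SignType) : 0 ≤ edgeProb p ζ s x := by
  unfold edgeProb
  split_ifs
  · exact mul_nonneg hp.1 (sub_nonneg.2 hζ.2)
  · exact mul_nonneg hp.1 hζ.1
  · exact sub_nonneg.2 hp.2

theorem rrProb_nonneg (ε : ℝ) (x y : SignType) : 0 ≤ rrProb ε x y := by
  unfold rrProb
  split_ifs <;> positivity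

theorem perturbedProb_nonneg {p ζ : ℝ} (hp : p ∈ Set.Icc (0 : ℝ) 1)
    (hζ : ζ ∈ Set.Icc (0 : ℝ) 1) (ε : ℝ) (s : ℤˣ) (y : SignType) :
    0 ≤ perturbedProb p ζ ε s y :=
  Finset.sum_nonneg fun _ _ => mul_nonneg (edgeProb_nonneg hp hζ _ _) (rrProb_nonneg _ _ _)

theorem lawOfWeights_singleton (w : SignType → ℝ) (x : SignType) :
    lawOfWeights w {x} = ENNReal.ofReal (w x) := by
  simp [lawOfWeights, Set.indicator_apply]

instance instIsFiniteMeasureLawOfWeights (w : SignType → ℝ) : IsFiniteMeasure (lawOfWeights w) := by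
  refine ⟨?_⟩
  simp only [lawOfWeights, Measure.coe_finsetSum, Finset.sum_apply, Measure.smul_apply,
    smul_eq_mul, measure_univ, mul_one]
  exact ENNReal.sum_lt_top.2 fun x _ => ENNReal.ofReal_lt_top

/-- Both stages act independently on the edges, so summing out the hidden graph factorizes: the
perturbed edges are again independent. -/
theorem perturbedLaw_singleton {n : ℕ} (σ : Labels n) {p ζ : ℝ} (hp : p ∈ Set.Icc (0 : ℝ) 1)
    (hζ : ζ ∈ Set.Icc (0 : ℝ) 1) (ε : ℝ) (G : SignedGraph n) :
    perturbedLaw σ p ζ ε {G}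
      = ENNReal.ofReal (prodWeight (fun e => perturbedProb p ζ ε (σ e.1.1 * σ e.1.2)) G) := by
  have hcbm : ∀ H : SignedGraph n, cbmLaw σ p ζ {H}
      = ENNReal.ofReal (∏ e, edgeProb p ζ (σ e.1.1 * σ e.1.2) (H e)) := by
    intro H
    rw [cbmLaw, Measure.pi_singleton,
      ENNReal.ofReal_prod_of_nonneg fun e _ => edgeProb_nonneg hp hζ _ _]
    simp only [lawOfWeights_singleton]
  have hker : ∀ H : SignedGraph n, perturbKernel n ε H {G}
      = ENNReal.ofReal (∏ e, rrProb ε (H e) (G e)) := by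
    intro H
    change (Measure.pi fun e => lawOfWeights (rrProb ε (H e))) {G} = _
    rw [Measure.pi_singleton, ENNReal.ofReal_prod_of_nonneg fun e _ => rrProb_nonneg _ _ _]
    simp only [lawOfWeights_singleton]
  rw [perturbedLaw, Measure.bind_apply (measurableSet_singleton G) (Kernel.aemeasurable _),
    lintegral_fintype]
  simp only [hcbm, hker]
  simp only [← ENNReal.ofReal_mul (Finset.prod_nonneg fun e _ => rrProb_nonneg ε _ _)]
  rw [← ENNReal.ofReal_sum_of_nonneg fun H _ => mul_nonneg
    (Finset.prod_nonneg fun e _ => rrProb_nonneg ε _ _)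
    (Finset.prod_nonneg fun e _ => edgeProb_nonneg hp hζ _ _)]
  congr 1
  simp only [prodWeight, perturbedProb]
  rw [Finset.prod_univ_sum, Fintype.piFinset_univ]
  refine Finset.sum_congr rfl fun H _ => ?_
  rw [← Finset.prod_mul_distrib]
  exact Finset.prod_congr rfl fun e _ => mul_comm _ _

open Classical in
theorem perturbedLaw_real_apply {n : ℕ} (σ : Labels n) {p ζ : ℝ} (hp : p ∈ Set.Icc (0 : ℝ) 1)
    (hζ : ζ ∈ Set.Icc (0 : ℝ) 1) (ε : ℝ) (S : Set (SignedGraph n)) :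
    (perturbedLaw σ p ζ ε).real S
      = ∑ G ∈ Finset.univ.filter (· ∈ S),
          prodWeight (fun e => perturbedProb p ζ ε (σ e.1.1 * σ e.1.2)) G := by
  have hS : S = ((Finset.univ.filter (· ∈ S) : Finset (SignedGraph n)) : Set (SignedGraph n)) := by
    ext G; simp
  conv_lhs => rw [hS]
  rw [measureReal_def, ← sum_measure_singleton]
  simp only [perturbedLaw_singleton σ hp hζ]
  rw [ENNReal.toReal_sum fun _ _ => ENNReal.ofReal_ne_top]
  exact Finset.sum_congr rfl fun G _ => ENNReal.toReal_ofReal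
    (Finset.prod_nonneg fun e _ => perturbedProb_nonneg hp hζ _ _ _)

/-- The mean of a perturbed edge between two vertices of the same community. -/
noncomputable def perturbedMean (p ζ ε : ℝ) : ℝ := p * (1 - 2 * ζ) * ((Real.exp ε - 1) / (Real.exp ε + 2))

/-- A perturbed edge, multiplied by the product of the labels and centered. -/
def centeredEdge (m : ℝ) (s : ℤˣ) (y : SignType) : ℝ := (s : ℤ) * (y : ℝ) - m

theorem sum_perturbedProb (p ζ ε : ℝ) (s : ℤˣ) : ∑ y, perturbedProb p ζ ε s y = 1 := by
  have h : Real.exp ε + 2 ≠ 0 := by positivity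
  rcases Int.units_eq_one_or s with rfl | rfl <;>
  · simp [sum_signType, perturbedProb, edgeProb, rrProb]
    field_simp
    ring

/-- Randomized response multiplies the conditional mean of an edge by `(exp ε - 1) / (exp ε + 2)`,
since its two wrong outputs are equally likely. -/
theorem sum_perturbedProb_mul_centeredEdge (p ζ ε : ℝ) (s : ℤˣ) :
    ∑ y, perturbedProb p ζ ε s y * centeredEdge (perturbedMean p ζ ε) s y = 0 := by
  have h : Real.exp ε + 2 ≠ 0 := by positivity
  rcases Int.units_eq_one_or s with rfl | rfl <;>
  · simp [sum_signType, perturbedProb, edgeProb, rrProb, centeredEdge, perturbedMean]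
    field_simp
    ring

/-- The term `p` accounts for revealed edges, the other for zeros turned into `±1`, which has
probability `2 / (exp ε + 2)`. -/
theorem sum_perturbedProb_mul_sq {p : ℝ} (hp : p ∈ Set.Icc (0 : ℝ) 1) (ζ ε : ℝ) (s : ℤˣ) :
    ∑ y, perturbedProb p ζ ε s y * (y : ℝ) ^ 2 ≤ p + 2 * (Real.exp ε)⁻¹ := by
  have hE := Real.exp_pos ε
  have heq : ∑ y, perturbedProb p ζ ε s y * (y : ℝ) ^ 2
      = p * ((Real.exp ε - 1) / (Real.exp ε + 2)) + 2 * (Real.exp ε + 2)⁻¹ := by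
    have h : Real.exp ε + 2 ≠ 0 := by positivity
    rcases Int.units_eq_one_or s with rfl | rfl <;>
    · simp [sum_signType, perturbedProb, edgeProb, rrProb]
      field_simp
      ring
  rw [heq]
  have h1 : p * ((Real.exp ε - 1) / (Real.exp ε + 2)) ≤ p :=
    mul_le_of_le_one_right hp.1 ((div_le_one (by positivity)).2 (by linarith))
  have h2 : (Real.exp ε + 2)⁻¹ ≤ (Real.exp ε)⁻¹ := by gcongr; linarith
  linarith

theorem sum_perturbedProb_mul_centeredEdge_sq {p : ℝ} (hp : p ∈ Set.Icc (0 : ℝ) 1) (ζ ε : ℝ)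
    (s : ℤˣ) :
    ∑ y, perturbedProb p ζ ε s y * centeredEdge (perturbedMean p ζ ε) s y ^ 2
      ≤ p + 2 * (Real.exp ε)⁻¹ := by
  have h0 := sum_perturbedProb p ζ ε s
  have h1 := sum_perturbedProb_mul_centeredEdge p ζ ε s
  have h2 := sum_perturbedProb_mul_sq hp ζ ε s
  set m := perturbedMean p ζ ε
  have key : ∀ y, perturbedProb p ζ ε s y * centeredEdge m s y ^ 2
      = perturbedProb p ζ ε s y * (y : ℝ) ^ 2
        - 2 * m * (perturbedProb p ζ ε s y * centeredEdge m s y)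
        - m ^ 2 * perturbedProb p ζ ε s y := by
    intro y
    have : ((s : ℤ) : ℝ) * ((s : ℤ) : ℝ) = 1 := by
      rcases Int.units_eq_one_or s with rfl | rfl <;> simp
    simp only [centeredEdge]
    linear_combination (perturbedProb p ζ ε s y * (y : ℝ) ^ 2) * this
  simp only [key, Finset.sum_sub_distrib, ← Finset.mul_sum, h0, h1]
  nlinarith [sq_nonneg m]

theorem abs_centeredEdge_le {m : ℝ} (hm : |m| ≤ 1) (s : ℤˣ) (y : SignType) :
    |centeredEdge m s y| ≤ 2 := by
  have h : |((s : ℤ) : ℝ) * (y : ℝ)| ≤ 1 := by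
    rcases Int.units_eq_one_or s with rfl | rfl <;> rcases y with _ | _ | _ <;> simp
  exact (abs_sub _ _).trans (by linarith)

theorem abs_perturbedMean_le {p ζ ε : ℝ} (hp : p ∈ Set.Icc (0 : ℝ) 1)
    (hζ : ζ ∈ Set.Icc (0 : ℝ) 1) : |perturbedMean p ζ ε| ≤ 1 := by
  have hE := Real.exp_pos ε
  have h1 : |p| ≤ 1 := abs_le.2 ⟨by linarith [hp.1], hp.2⟩
  have h2 : |1 - 2 * ζ| ≤ 1 := abs_le.2 ⟨by linarith [hζ.2], by linarith [hζ.1]⟩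
  have h3 : |(Real.exp ε - 1) / (Real.exp ε + 2)| ≤ 1 := by
    rw [abs_div, abs_of_pos (by positivity : 0 < Real.exp ε + 2), div_le_one (by positivity)]
    exact abs_le.2 ⟨by linarith, by linarith⟩
  rw [perturbedMean, abs_mul, abs_mul]
  exact mul_le_one₀ (mul_le_one₀ h1 (abs_nonneg _) h2) (abs_nonneg _) h3

/-! ### Moments of the noise matrix and the failure probability -/

/-- The edge between two distinct vertices. -/
def edgeOf {n : ℕ} (i j : Fin n) (h : i ≠ j) : Edge n :=
  if hij : i < j then ⟨(i, j), hij⟩ else ⟨(j, i), lt_of_le_of_ne (not_lt.1 hij) h.symm⟩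

theorem mk_edgeOf {n : ℕ} (i j : Fin n) (h : i ≠ j) :
    s((edgeOf i j h).1.1, (edgeOf i j h).1.2) = s(i, j) := by
  unfold edgeOf
  split_ifs
  · rfl
  · exact Sym2.eq_swap

theorem edge_mk_injective (n : ℕ) :
    Function.Injective fun e : Edge n => s(e.1.1, e.1.2) := by
  rintro ⟨⟨i, j⟩, hij⟩ ⟨⟨k, l⟩, hkl⟩ h
  rcases Sym2.eq_iff.1 h with ⟨h1, h2⟩ | ⟨h1, h2⟩
  · exact Subtype.ext (Prod.ext h1 h2)
  · exact absurd (hij.trans_eq h2) (by rw [h1]; exact not_lt.2 hkl.le)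

theorem noiseMatrix_apply_of_ne {n : ℕ} (σ : Labels n) (m : ℝ) (G : SignedGraph n) (i j : Fin n)
    (h : i ≠ j) :
    noiseMatrix σ m G i j = centeredEdge m (σ (edgeOf i j h).1.1 * σ (edgeOf i j h).1.2)
      (G (edgeOf i j h)) := by
  unfold edgeOf
  split_ifs with hij
  · simp [noiseMatrix, h, centeredEdge, realLabel, adjMatrix, hij]
  · have hji : j < i := lt_of_le_of_ne (not_lt.1 hij) h.symm
    simp [noiseMatrix, h, centeredEdge, realLabel, adjMatrix, hij, hji, mul_comm]

section moments

variable {n : ℕ} {p ζ ε z : ℝ} (σ : Labels n)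

/-- Mixed moments of the centered adjacency matrix along a family of vertex pairs. -/
theorem sum_prodWeight_mul_prod_noiseMatrix_le (hn : 0 < n) (hp : p ∈ Set.Icc (0 : ℝ) 1)
    (hζ : ζ ∈ Set.Icc (0 : ℝ) 1) (hz : 1 ≤ z) (hpz : p + 2 * (Real.exp ε)⁻¹ ≤ z * (n : ℝ)⁻¹)
    {k : ℕ} (u v : Fin (2 * k) → Fin n) :
    ∑ G, prodWeight (fun e : Edge n => perturbedProb p ζ ε (σ e.1.1 * σ e.1.2)) G
        * ∏ t, noiseMatrix σ (perturbedMean p ζ ε) G (u t) (v t)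
      ≤ 2 ^ (2 * k) * z ^ k * (n : ℝ)⁻¹ ^ (Finset.univ.image fun t => s(u t, v t)).card := by
  have hn' : (0 : ℝ) < n := by exact_mod_cast hn
  by_cases h : ∀ t, u t ≠ v t
  · set f : Fin (2 * k) → Edge n := fun t => edgeOf (u t) (v t) (h t) with hf
    have hcard : (Finset.univ.image fun t => s(u t, v t)).card = (Finset.univ.image f).card := by
      rw [← Finset.card_image_of_injective (Finset.univ.image f) (edge_mk_injective n),
        Finset.image_image]
      congr 1
      exact Finset.image_congr fun t _ => (mk_edgeOf _ _ (h t)).symm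
    rw [hcard]
    simp only [fun G t => noiseMatrix_apply_of_ne σ (perturbedMean p ζ ε) G (u t) (v t) (h t)]
    exact sum_prodWeight_mul_prod_comp_le
      (w := fun e : Edge n => perturbedProb p ζ ε (σ e.1.1 * σ e.1.2))
      (g := fun e : Edge n => centeredEdge (perturbedMean p ζ ε) (σ e.1.1 * σ e.1.2))
      (fun e x => perturbedProb_nonneg hp hζ _ _ _) (fun e => sum_perturbedProb p ζ ε _)
      (fun e => sum_perturbedProb_mul_centeredEdge p ζ ε _)
      (fun e => (sum_perturbedProb_mul_centeredEdge_sq hp ζ ε _).trans hpz)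
      (fun e x => abs_centeredEdge_le (abs_perturbedMean_le hp hζ) _ _) hz hn' f
  · push Not at h
    obtain ⟨t, ht⟩ := h
    refine le_of_eq_of_le (Finset.sum_eq_zero fun G _ => ?_) (by positivity)
    rw [Finset.prod_eq_zero (Finset.mem_univ t) (by simp [noiseMatrix, ht]), mul_zero]

/-- The mixed-moment bound counts distinct edges; passing to distinct vertices costs a single factor
`n`. Walks then become words of length `2 * k + 1`, which gives the factorial. -/
theorem sum_prodWeight_mul_trace_pow_le (hn : 0 < n) (hp : p ∈ Set.Icc (0 : ℝ) 1)
    (hζ : ζ ∈ Set.Icc (0 : ℝ) 1) (hz : 1 ≤ z) (hpz : p + 2 * (Real.exp ε)⁻¹ ≤ z * (n : ℝ)⁻¹)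
    (k : ℕ) :
    ∑ G, prodWeight (fun e : Edge n => perturbedProb p ζ ε (σ e.1.1 * σ e.1.2)) G
        * (noiseMatrix σ (perturbedMean p ζ ε) G ^ (2 * k)).trace
      ≤ 2 ^ (2 * k) * z ^ k * (n * (2 * k + 1).factorial) := by
  have hn' : (1 : ℝ) ≤ n := by exact_mod_cast hn
  simp only [trace_pow_eq_sum_walk, Finset.mul_sum]
  rw [Finset.sum_comm]
  have hwalk : ∀ w : Fin (2 * k + 1) → Fin n,
      ∑ G, prodWeight (fun e : Edge n => perturbedProb p ζ ε (σ e.1.1 * σ e.1.2)) G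
        * (if w 0 = w (Fin.last (2 * k)) then ∏ t : Fin (2 * k),
            noiseMatrix σ (perturbedMean p ζ ε) G (w t.castSucc) (w t.succ) else 0)
      ≤ 2 ^ (2 * k) * z ^ k * (n * (n : ℝ)⁻¹ ^ (Finset.univ.image w).card) := by
    intro w
    have hcount : (n : ℝ)⁻¹ ^ (Finset.univ.image fun t : Fin (2 * k) =>
        s(w t.castSucc, w t.succ)).card ≤ n * (n : ℝ)⁻¹ ^ (Finset.univ.image w).card := by
      have hinv : (n : ℝ) * (n : ℝ)⁻¹ = 1 := mul_inv_cancel₀ (by positivity)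
      calc _ = n * (n : ℝ)⁻¹ ^ ((Finset.univ.image fun t : Fin (2 * k) =>
            s(w t.castSucc, w t.succ)).card + 1) := by rw [pow_succ', ← mul_assoc, hinv, one_mul]
        _ ≤ _ := mul_le_mul_of_nonneg_left (pow_le_pow_of_le_one (by positivity)
            (inv_le_one_of_one_le₀ hn') (card_image_le_card_image_edge_add_one w)) (by positivity)
    split_ifs
    · refine (sum_prodWeight_mul_prod_noiseMatrix_le σ hn hp hζ hz hpz _ _).trans ?_
      exact mul_le_mul_of_nonneg_left hcount (by positivity)
    · simp only [mul_zero, Finset.sum_const_zero]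
      positivity
  refine (Finset.sum_le_sum fun w _ => hwalk w).trans ?_
  rw [← Finset.mul_sum, ← Finset.mul_sum]
  have := sum_inv_pow_card_image_le (V := Fin n) (2 * k + 1)
  rw [Fintype.card_fin] at this
  gcongr

/-- The pairs form a star at `i`, so distinct pairs correspond to distinct endpoints and no factor
`n` is lost. -/
theorem sum_prodWeight_mul_row_sum_pow_le (hn : 0 < n) (hp : p ∈ Set.Icc (0 : ℝ) 1)
    (hζ : ζ ∈ Set.Icc (0 : ℝ) 1) (hz : 1 ≤ z) (hpz : p + 2 * (Real.exp ε)⁻¹ ≤ z * (n : ℝ)⁻¹)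
    (k : ℕ) (i : Fin n) :
    ∑ G, prodWeight (fun e : Edge n => perturbedProb p ζ ε (σ e.1.1 * σ e.1.2)) G
        * (∑ j, noiseMatrix σ (perturbedMean p ζ ε) G i j) ^ (2 * k)
      ≤ 2 ^ (2 * k) * z ^ k * (2 * k).factorial := by
  simp only [Finset.sum_pow', Fintype.piFinset_univ, Finset.mul_sum]
  rw [Finset.sum_comm]
  have := sum_inv_pow_card_image_le (V := Fin n) (2 * k)
  rw [Fintype.card_fin] at this
  refine le_trans (Finset.sum_le_sum fun f _ => ?_) (b := ∑ f : Fin (2 * k) → Fin n,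
    2 ^ (2 * k) * z ^ k * (n : ℝ)⁻¹ ^ (Finset.univ.image f).card) ?_
  · refine (sum_prodWeight_mul_prod_noiseMatrix_le σ hn hp hζ hz hpz (fun _ => i) f).trans_eq ?_
    have hinj : Function.Injective fun j : Fin n => s(i, j) := fun a b h => Sym2.congr_right.1 h
    rw [← Finset.card_image_of_injective (Finset.univ.image f) hinj, Finset.image_image]
    rfl
  · rw [← Finset.mul_sum]
    gcongr

/-- Exact recovery fails with a probability controlled by the moments of the noise. -/
theorem one_sub_le_perturbedLaw_real (hn : 0 < n) (hp : p ∈ Set.Icc (0 : ℝ) 1)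
    (hζ : ζ ∈ Set.Icc (0 : ℝ) 1) (hz : 1 ≤ z) (hpz : p + 2 * (Real.exp ε)⁻¹ ≤ z * (n : ℝ)⁻¹)
    (hm : 0 < perturbedMean p ζ ε) (r : ℕ) :
    1 - 2 * (2 * 2 ^ r + 1).factorial * (n * (64 * z / (n * perturbedMean p ζ ε) ^ 2) ^ 2 ^ r)
      ≤ (perturbedLaw σ p ζ ε).real {G | SDPRecovers σ G} := by
  classical
  set m := perturbedMean p ζ ε with hmdef
  set k := 2 ^ r with hk
  -- A choice satisfying `2 * τ < n * m`; it makes `4 * z / τ ^ 2` equal to `64 * z / (n * m) ^ 2`.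
  set τ : ℝ := n * m / 4 with hτ
  have hn' : (0 : ℝ) < n := by exact_mod_cast hn
  have hτ0 : 0 < τ := by positivity
  set W := prodWeight (fun e : Edge n => perturbedProb p ζ ε (σ e.1.1 * σ e.1.2)) with hW
  have hW0 : ∀ G, 0 ≤ W G := fun G =>
    Finset.prod_nonneg fun e _ => perturbedProb_nonneg hp hζ _ _ _
  have hsum : ∑ G, W G = 1 := sum_prodWeight fun e => sum_perturbedProb _ _ _ _
  -- Markov's inequality pointwise: on failure the trace or one of the row sums exceeds its
  -- threshold, and all these even-order quantities are nonnegative.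
  have hpoint : ∀ G, (if SDPRecovers σ G then 0 else W G) * τ ^ (2 * k)
      ≤ W G * (noiseMatrix σ m G ^ (2 * k)).trace
        + ∑ i, W G * (∑ j, noiseMatrix σ m G i j) ^ (2 * k) := by
    intro G
    have hrow0 : ∀ i, 0 ≤ W G * (∑ j, noiseMatrix σ m G i j) ^ (2 * k) := fun i =>
      mul_nonneg (hW0 G) (by rw [pow_mul]; positivity)
    have htr0 : 0 ≤ (noiseMatrix σ m G ^ (2 * k)).trace := by
      have hs := (noiseMatrix_isSymm σ m G).pow k
      rw [two_mul, pow_add, Matrix.trace]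
      refine Finset.sum_nonneg fun i _ => ?_
      rw [Matrix.diag_apply, Matrix.mul_apply]
      refine Finset.sum_nonneg fun j _ => ?_
      rw [hs.apply i j]
      exact mul_self_nonneg _
    split_ifs with hrec
    · rw [zero_mul]
      exact add_nonneg (mul_nonneg (hW0 G) htr0) (Finset.sum_nonneg fun i _ => hrow0 i)
    · by_cases hrow : ∀ i, |∑ j, noiseMatrix σ m G i j| ≤ τ
      · have htr : τ ^ (2 * k) < (noiseMatrix σ m G ^ (2 * k)).trace := by
          by_contra! hle
          rw [hk, ← pow_succ'] at hle
          exact hrec (sdpRecovers_of_trace_pow_le hn σ G hτ0.le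
            (by rw [hτ]; nlinarith [mul_pos hn' hm]) hrow hle)
        exact (mul_le_mul_of_nonneg_left htr.le (hW0 G)).trans
          (le_add_of_nonneg_right (Finset.sum_nonneg fun i _ => hrow0 i))
      · push Not at hrow
        obtain ⟨i, hi⟩ := hrow
        have hpow : τ ^ (2 * k) ≤ (∑ j, noiseMatrix σ m G i j) ^ (2 * k) := by
          rw [← (even_two_mul k).pow_abs (∑ j, noiseMatrix σ m G i j)]
          exact pow_le_pow_left₀ hτ0.le hi.le _
        exact ((mul_le_mul_of_nonneg_left hpow (hW0 G)).trans
          (Finset.single_le_sum (fun i _ => hrow0 i) (Finset.mem_univ i))).trans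
          (le_add_of_nonneg_left (mul_nonneg (hW0 G) htr0))
  have hbad : (∑ G, if SDPRecovers σ G then 0 else W G) * τ ^ (2 * k)
      ≤ 2 ^ (2 * k) * z ^ k * (2 * (n * (2 * k + 1).factorial)) := by
    rw [Finset.sum_mul]
    refine (Finset.sum_le_sum fun G _ => hpoint G).trans ?_
    rw [Finset.sum_add_distrib, Finset.sum_comm]
    have h1 := sum_prodWeight_mul_trace_pow_le σ hn hp hζ hz hpz k
    have h2 : ∑ i, ∑ G, W G * (∑ j, noiseMatrix σ m G i j) ^ (2 * k)
        ≤ ∑ i : Fin n, 2 ^ (2 * k) * z ^ k * (2 * k + 1).factorial := by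
      refine Finset.sum_le_sum fun i _ =>
        (sum_prodWeight_mul_row_sum_pow_le σ hn hp hζ hz hpz k i).trans ?_
      gcongr
      omega
    rw [Finset.sum_const, Finset.card_univ, Fintype.card_fin, nsmul_eq_mul] at h2
    linarith
  have hprob : (perturbedLaw σ p ζ ε).real {G | SDPRecovers σ G}
      = 1 - ∑ G, if SDPRecovers σ G then 0 else W G := by
    rw [perturbedLaw_real_apply σ hp hζ, ← hsum, ← Finset.sum_sub_distrib, Finset.sum_filter]
    refine Finset.sum_congr rfl fun G _ => ?_
    by_cases h : SDPRecovers σ G <;> simp [h, hW]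
  rw [hprob]
  have hle := (le_div_iff₀ (by positivity)).2 hbad
  refine sub_le_sub_left (hle.trans_eq ?_) 1
  have h64 : (64 * z / (n * m) ^ 2) ^ k = 2 ^ (2 * k) * z ^ k / τ ^ (2 * k) := by
    rw [pow_mul, pow_mul, ← mul_pow, ← div_pow]
    congr 1
    rw [hτ]
    field_simp
    norm_num
  rw [h64]
  ring

end moments

/-! ### Asymptotics -/

/-- The density condition forces the expected degree to be at least `√n`. -/
theorem sqrt_le_mul_of_density {n : ℕ} (hn : 2 ≤ n) {a p : ℝ} (hp : p = a * Real.log n / n)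
    (ha : 2 * ((n : ℝ) ^ (3 / 2 : ℝ) - n) / (((n : ℝ) - 1) * Real.log n) < a) :
    Real.sqrt n ≤ n * p := by
  have hn2 : (2 : ℝ) ≤ n := by exact_mod_cast hn
  have hlog : 0 < Real.log n := Real.log_pos (by linarith)
  have hnp : n * p = a * Real.log n := by rw [hp]; field_simp
  set s := Real.sqrt n with hs
  have hss : s * s = n := Real.mul_self_sqrt (by positivity)
  have hs1 : 1 < s := by rw [hs, Real.lt_sqrt (by norm_num)]; linarith
  have hpow : (n : ℝ) ^ (3 / 2 : ℝ) = n * s := by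
    rw [hs, Real.sqrt_eq_rpow, ← Real.rpow_one_add' (by positivity) (by norm_num)]
    norm_num
  rw [div_lt_iff₀ (mul_pos (by linarith) hlog), hpow] at ha
  rw [hnp]
  -- With `n = s ^ 2` the difference of the two sides is `s * (s - 1) ^ 2`.
  have h1 : s * ((n : ℝ) - 1) ≤ 2 * (n * s - n) := by
    rw [← hss]
    nlinarith [mul_nonneg (by linarith : 0 ≤ s) (mul_self_nonneg (s - 1))]
  have h2 : s * ((n : ℝ) - 1) ≤ a * Real.log n * ((n : ℝ) - 1) := by nlinarith
  exact le_of_mul_le_mul_right h2 (by linarith)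

/-- The noise-to-signal ratio decays polynomially. -/
theorem noise_ratio_le {n : ℕ} (hn : 2 ≤ n) {p ζ ε c : ℝ} (hζ : ζ ∈ Set.Ioo (0 : ℝ) (1 / 2))
    (hc : c ≤ 1 / 2) (hnp : Real.sqrt n ≤ n * p) (hε : (n : ℝ) ^ c ≤ Real.exp ε)
    (hexp : 2 ≤ Real.exp ε) :
    64 * (n * (p + 2 * (Real.exp ε)⁻¹)) / (n * perturbedMean p ζ ε) ^ 2
      ≤ 3072 / (1 - 2 * ζ) ^ 2 * (n : ℝ) ^ (-c) := by
  have hn0 : (0 : ℝ) < n := by positivity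
  have hδ : 0 < 1 - 2 * ζ := by linarith [hζ.2]
  have hsqrt : 0 < Real.sqrt n := Real.sqrt_pos.2 hn0
  set d := n * p with hd
  have hd0 : 0 < d := hsqrt.trans_le hnp
  have hp0 : 0 < p := pos_of_mul_pos_right hd0 hn0.le
  set x := (n : ℝ) ^ (-c) with hx
  have hx0 : 0 < x := Real.rpow_pos_of_pos hn0 _
  have hinv : (Real.exp ε)⁻¹ ≤ x := by
    rw [hx, Real.rpow_neg hn0.le]
    gcongr
  have hnd : (n : ℝ) ≤ d ^ 2 := by
    calc (n : ℝ) = Real.sqrt n ^ 2 := (Real.sq_sqrt hn0.le).symm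
      _ ≤ d ^ 2 := by gcongr
  have hdx : 1 ≤ d * x := by
    have h1 : (Real.sqrt n)⁻¹ ≤ x := by
      rw [hx, Real.sqrt_eq_rpow, ← Real.rpow_neg hn0.le]
      exact Real.rpow_le_rpow_of_exponent_le (by exact_mod_cast (by omega : 1 ≤ n)) (by linarith)
    calc 1 = Real.sqrt n * (Real.sqrt n)⁻¹ := (mul_inv_cancel₀ hsqrt.ne').symm
      _ ≤ d * x := by gcongr
  -- The model variance uses `1 ≤ d * x`, which needs `c ≤ 1 / 2`; the privacy noise uses `n ≤ d ^
  -- 2`. Together with the factor `1 / 4` in the mean this gives `3072 = 64 * 3 * 16`.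
  have hz : n * (p + 2 * (Real.exp ε)⁻¹) ≤ 3 * d ^ 2 * x := by
    have h1 : d ≤ d ^ 2 * x := by nlinarith
    have h2 : (n : ℝ) * (Real.exp ε)⁻¹ ≤ d ^ 2 * x := by gcongr
    rw [mul_add, ← hd]
    linarith
  have hmean : d * (1 - 2 * ζ) / 4 ≤ n * perturbedMean p ζ ε := by
    have h1 : 1 / 4 ≤ (Real.exp ε - 1) / (Real.exp ε + 2) := by
      rw [div_le_div_iff₀ (by norm_num) (by positivity)]; linarith
    calc d * (1 - 2 * ζ) / 4 = d * (1 - 2 * ζ) * (1 / 4) := by ring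
      _ ≤ d * (1 - 2 * ζ) * ((Real.exp ε - 1) / (Real.exp ε + 2)) := by gcongr
      _ = _ := by rw [perturbedMean, hd]; ring
  calc 64 * (n * (p + 2 * (Real.exp ε)⁻¹)) / (n * perturbedMean p ζ ε) ^ 2
      ≤ 64 * (3 * d ^ 2 * x) / (d * (1 - 2 * ζ) / 4) ^ 2 := by gcongr
    _ = 3072 / (1 - 2 * ζ) ^ 2 * x := by field_simp; norm_num

theorem tendsto_natCast_mul_pow_rpow_neg {c : ℝ} {k : ℕ} (hk : 1 < c * k) (K : ℝ) :
    Tendsto (fun n : ℕ => (n : ℝ) * (K * (n : ℝ) ^ (-c)) ^ k) atTop (𝓝 0) := by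
  have h := ((tendsto_rpow_neg_atTop (sub_pos.2 hk)).comp
    (tendsto_natCast_atTop_atTop (R := ℝ))).const_mul (K ^ k)
  rw [mul_zero] at h
  refine h.congr' ?_
  filter_upwards [eventually_gt_atTop 0] with n hn
  have hn0 : (0 : ℝ) < n := by exact_mod_cast hn
  simp only [Function.comp_apply]
  rw [mul_pow, ← Real.rpow_natCast ((n : ℝ) ^ (-c)) k, ← Real.rpow_mul hn0.le, mul_left_comm,
    ← Real.rpow_one_add' hn0.le (by linarith)]
  congr 2
  ring

end CBM

theorem mainTheorem1
    (ζ : ℝ) (hζ : ζ ∈ Set.Ioo (0 : ℝ) (1 / 2))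
    (a p ε : ℕ → ℝ) (σ : ∀ n : ℕ, CBM.Labels n)
    (hp : ∀ᶠ n : ℕ in atTop, p n = a n * Real.log n / n)
    (hp_le : ∀ᶠ n : ℕ in atTop, p n ≤ 1)
    (hε : ∃ c : ℝ, 0 < c ∧ ∀ᶠ n : ℕ in atTop, c * Real.log n ≤ ε n)
    (ha : ∀ᶠ n : ℕ in atTop,
      2 * ((n : ℝ) ^ (3 / 2 : ℝ) - n) / (((n : ℝ) - 1) * Real.log n) < a n)
    (hthr : ∀ᶠ n : ℕ in atTop,
      Real.sqrt n / (Real.sqrt n - 1) * ((Real.exp (ε n) + 1) / (Real.exp (ε n) - 1))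
        < a n * (Real.sqrt (1 - ζ) - Real.sqrt ζ) ^ 2) :
    Tendsto
      (fun n : ℕ => (CBM.perturbedLaw (σ n) (p n) ζ (ε n)).real
        {G | CBM.SDPRecovers (σ n) G})
      atTop (𝓝 1) := by
  obtain ⟨c₀, hc₀, hε⟩ := hε
  -- The decay exponent is capped by the privacy rate and by the degree bound `√n`. The power `2 ^
  -- r` below is then fixed with `c * 2 ^ r > 1`, to beat the factor `n` in the failure bound.
  set c := min c₀ (1 / 2) with hc
  have hc0 : 0 < c := lt_min hc₀ (by norm_num)
  obtain ⟨r, hr⟩ := pow_unbounded_of_one_lt c⁻¹ (one_lt_two (α := ℝ))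
  have hk : 1 < c * ((2 ^ r : ℕ) : ℝ) := by
    push_cast
    exact (inv_lt_iff_one_lt_mul₀' hc0).1 hr
  have hζ' : ζ ∈ Set.Icc (0 : ℝ) 1 := ⟨hζ.1.le, by linarith [hζ.2]⟩
  have hexp : ∀ᶠ n : ℕ in atTop, (2 : ℝ) ≤ (n : ℝ) ^ c :=
    ((tendsto_rpow_atTop hc0).comp (tendsto_natCast_atTop_atTop (R := ℝ))).eventually_ge_atTop 2
  have hlim := (CBM.tendsto_natCast_mul_pow_rpow_neg hk (3072 / (1 - 2 * ζ) ^ 2)).const_mul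
    (2 * ((2 * 2 ^ r + 1).factorial : ℝ)) |>.const_sub 1
  rw [mul_zero, sub_zero] at hlim
  have hev : ∀ᶠ n : ℕ in atTop, 0 < n ∧ p n ∈ Set.Icc (0 : ℝ) 1 ∧ Real.sqrt n ≤ n * p n ∧
      2 ≤ n ∧ (n : ℝ) ^ c ≤ Real.exp (ε n) ∧ 2 ≤ Real.exp (ε n) := by
    filter_upwards [hp, hp_le, hε, ha, hexp, eventually_ge_atTop 2] with n hp hp1 hε ha hexp hn
    have hn0 : (0 : ℝ) < n := by positivity
    have hlog : 0 ≤ Real.log n := Real.log_natCast_nonneg n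
    have hnp := CBM.sqrt_le_mul_of_density hn hp ha
    have hle : (n : ℝ) ^ c ≤ Real.exp (ε n) := by
      rw [Real.rpow_def_of_pos hn0, Real.exp_le_exp, mul_comm]
      exact (mul_le_mul_of_nonneg_right (min_le_left _ _) hlog).trans hε
    exact ⟨by omega, ⟨(pos_of_mul_pos_right ((Real.sqrt_pos.2 hn0).trans_le hnp) hn0.le).le, hp1⟩,
      hnp, hn, hle, hexp.trans hle⟩
  refine tendsto_of_tendsto_of_tendsto_of_le_of_le' hlim tendsto_const_nhds ?_ ?_
  · filter_upwards [hev] with n ⟨hn, hpn, hnp, hn2, hle, hexp⟩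
    have hn0 : (0 : ℝ) < n := by exact_mod_cast hn
    have hp0 : 0 < p n := pos_of_mul_pos_right ((Real.sqrt_pos.2 hn0).trans_le hnp) hn0.le
    have hz : 1 ≤ n * (p n + 2 * (Real.exp (ε n))⁻¹) := by
      have h1 : 1 ≤ Real.sqrt n := Real.one_le_sqrt.2 (by exact_mod_cast hn)
      have h2 : 0 ≤ (n : ℝ) * (2 * (Real.exp (ε n))⁻¹) := by positivity
      rw [mul_add]
      linarith
    have hm : 0 < CBM.perturbedMean (p n) ζ (ε n) :=
      mul_pos (mul_pos hp0 (by linarith [hζ.2])) (div_pos (by linarith) (by linarith))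
    refine le_trans ?_ (CBM.one_sub_le_perturbedLaw_real (σ n) hn hpn hζ' hz
      (by rw [mul_comm (n : ℝ), mul_assoc, mul_inv_cancel₀ hn0.ne', mul_one]) hm r)
    gcongr
    exact CBM.noise_ratio_le hn2 hζ (min_le_right _ _) hnp hle hexp
  · filter_upwards [hev] with n ⟨hn, hpn, hnp, hn2, hle, hexp⟩
    rw [CBM.perturbedLaw_real_apply (σ n) hpn hζ', ← CBM.sum_prodWeight
      (w := fun e : CBM.Edge n => CBM.perturbedProb (p n) ζ (ε n) (σ n e.1.1 * σ n e.1.2))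
      fun e => CBM.sum_perturbedProb _ _ _ _]
    exact Finset.sum_le_sum_of_subset_of_nonneg (Finset.subset_univ _) fun G _ _ =>
      Finset.prod_nonneg fun e _ => CBM.perturbedProb_nonneg hpn hζ' _ _ _
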